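/- Let $\mathbb{N}=\{1,2,3,\dots\}$. For $x,y\in\{0,1\}^{\mathbb{N}}$ put $$d_B(x,y)=\limsup_{N\to\infty}\frac{|\{1\le n\le N: x(n)\ne y(n)\}|}{N}.$$ A set $R\subset\mathbb{N}$ is called rational if for every $\varepsilon>0$ there is a periodic sequence $y\in\{0,1\}^{\mathbb{N}}$ with $d_B(\mathbf{1}_R,y)<\varepsilon$. Let $A\subset\mathbb{N}\setminus\{1\}$ be such that (1) the density $d(A)=\lim_{N\to\infty}\frac1N|A\cap\{1,\dots,N\}|$ exists, and (2) $nA\subset A$ for all $n\in\mathbb{N}$. Then $A$ is a rational set. In particular, the set $\{n\in\mathbb{N}:\sigma(n)>2n\}$ of abundant numbers, the set $\{n\in\mathbb{N}:\sigma(n)<2n\}$ of deficient numbers (where $\sigma(n)=\sum_{d\mid n}d$) and, for every real $x\in[0,1]$, the set $\Phi_x=\{n\in\mathbb{N}:\varphi(n)/n<x\}$ (where $\varphi$ is Euler's totient function) are rational sets. -/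

import Mathlib

open Filter Topology

noncomputable section

/-- Throughout, the natural numbers `{1, 2, 3, …}` are `ℕ+`.
`prefixCount A N` is the number of elements of `A` among `1, …, N`. -/
def prefixCount (A : Set ℕ+) (N : ℕ) : ℕ :=
  {n : ℕ+ | (n : ℕ) ≤ N ∧ n ∈ A}.ncard

/-- The natural density of `A` exists and equals `d`. -/
def HasDensity (A : Set ℕ+) (d : ℝ) : Prop :=
  Tendsto (fun N : ℕ => (prefixCount A N : ℝ) / (N : ℝ)) atTop (𝓝 d)

/-- The Besicovitch pseudo-metric
`d_B(x, y) = limsup_N |{1 ≤ n ≤ N : x(n) ≠ y(n)}| / N` on sequences over an alphabet.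
The quotients lie in `[0, 1]`, so this limsup of reals is the genuine one. -/
def besicovitchDist {𝒜 : Type*} (x y : ℕ+ → 𝒜) : ℝ :=
  limsup (fun N : ℕ => (prefixCount {n | x n ≠ y n} N : ℝ) / (N : ℝ)) atTop

/-- Besicovitch rationally almost periodic sequences over a finite alphabet: those that are
approximated arbitrarily well in `d_B` by periodic sequences (the period is a positive integer). -/
def IsRAP {𝒜 : Type*} [Finite 𝒜] (x : ℕ+ → 𝒜) : Prop :=
  ∀ ε : ℝ, 0 < ε →
    ∃ y : ℕ+ → 𝒜, (∃ p : ℕ+, Function.Periodic y p) ∧ besicovitchDist x y < ε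

/-- A set of positive integers is rational if its indicator sequence, viewed as a sequence over
the two-letter alphabet `{0, 1}`, is rationally almost periodic. -/
def IsRationalSet (R : Set ℕ+) : Prop :=
  IsRAP (R.indicator (1 : ℕ+ → Fin 2))

/-- Abundant numbers: `σ(n) > 2n`, where `σ(n)` is the sum of all divisors of `n`. -/
def abundantNumbers : Set ℕ+ :=
  {n | ArithmeticFunction.sigma 1 (n : ℕ) > 2 * (n : ℕ)}

/-- Deficient numbers: `σ(n) < 2n`. -/
def deficientNumbers : Set ℕ+ :=
  {n | ArithmeticFunction.sigma 1 (n : ℕ) < 2 * (n : ℕ)}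

/-- `Φ_x = {n : φ(n)/n < x}`, where `φ` is Euler's totient function. -/
def totientRatioSet (x : ℝ) : Set ℕ+ :=
  {n | (Nat.totient (n : ℕ) : ℝ) / ((n : ℕ) : ℝ) < x}

end

/-!
Both parts approximate the given set `A` by periodic sets.

**Sets closed under multiples.** Let `A_k` consist of the multiples of the elements of `A` up to
`k`. This is a set of period `k!` contained in `A`, so it suffices that the densities `d(A_k)` come
arbitrarily close to `d(A)`, which is a weak form of the Davenport–Erdős theorem. Consider the zeta
distribution `P_s`, which gives `n` the mass `n⁻ˢ / ζ(s)` for `s > 1`. For a set `U` closed under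
multiples, `P_s(U)` decreases in `s`: this is a correlation inequality for the distributive lattice
of divisors of `j!`, followed by `j → ∞` (`dirichletSum_div_antitone`). If `U` has a natural
density, then `P_s(U) → d(U)` as `s → 1⁺` by the Abelian theorem
(`HasDensity.tendsto_dirichletSum_div`). Hence `P_t(A_k) ≤ d(A_k)` for all `t > 1`. If all `d(A_k)`
were at most `d(A) - ε`, then `k → ∞` would give `P_t(A) ≤ d(A) - ε`, and `t → 1⁺` would give
`d(A) ≤ d(A) - ε`.

**Abundant, deficient and totient sets.** These are level sets `{h < t}` or `{h > t}` with `t > 0`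
of a function `h(n) = ∑_{d ∣ n} c(d) / d` with `|c| ≤ 1`, namely `σ(n)/n` with `c = 1` and `φ(n)/n`
with the Möbius function. They are treated directly, which makes it unnecessary to prove separately
that they have a density. The function `h_K(n) = h(gcd(n, K!))` has period `K!`, and the mean value
of `|h - h_K|` is at most `∑_{d > K} 1/d² ≤ 1/K`, so the level sets of `h` and `h_K` differ little
unless `h_K` concentrates near `t`. That it does not (`IsDivisorRatio.exists_concentration_bound`)
is seen as follows: let `S` be the set of `n` with `|h_K(n) - t| ≤ δ`. For `n ∈ S` and a prime
`p ∤ n` with `p ≤ K`, the value `h_K(pn) = h(p) h_K(n)` is close to `h(p) t`. As `h` takes distinct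
values at distinct primes, the sets `p • (S \ pℕ)`, for `p` in a given finite set `P` of primes,
are disjoint once `δ` is small. Comparing densities, `d(S) ∑_{p ∈ P} 1/p ≤ 1 + ∑_{p ∈ P} 1/p²`, and
`∑ 1/p` over the primes diverges.
-/

/-! ### Counting in initial segments and natural density -/

lemma finite_prefix (A : Set ℕ+) (N : ℕ) : {n : ℕ+ | (n : ℕ) ≤ N ∧ n ∈ A}.Finite :=
  (Set.Finite.preimage PNat.coe_injective.injOn (Set.finite_Iic N)).subset fun _ hn => hn.1

lemma prefixCount_mono {A B : Set ℕ+} (h : A ⊆ B) (N : ℕ) : prefixCount A N ≤ prefixCount B N :=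
  Set.ncard_le_ncard (fun _ hn => ⟨hn.1, h hn.2⟩) (finite_prefix B N)

lemma prefixCount_union_le (A B : Set ℕ+) (N : ℕ) :
    prefixCount (A ∪ B) N ≤ prefixCount A N + prefixCount B N := by
  refine le_trans (le_of_eq ?_) (Set.ncard_union_le _ _)
  unfold prefixCount
  congr 1
  ext n
  simp only [Set.mem_ofPred_eq, Set.mem_union]
  tauto

lemma prefixCount_add_prefixCount_diff {A B : Set ℕ+} (h : B ⊆ A) (N : ℕ) :
    prefixCount B N + prefixCount (A \ B) N = prefixCount A N := by
  have hd : Disjoint {n : ℕ+ | (n : ℕ) ≤ N ∧ n ∈ B} {n : ℕ+ | (n : ℕ) ≤ N ∧ n ∈ A \ B} :=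
    Set.disjoint_left.2 fun n h₁ h₂ => h₂.2.2 h₁.2
  unfold prefixCount
  rw [← Set.ncard_union_eq hd (finite_prefix _ _) (finite_prefix _ _)]
  congr 1
  ext n
  have := @h n
  simp only [Set.mem_ofPred_eq, Set.mem_union, Set.mem_sdiff]
  tauto

open Classical in
lemma prefixCount_eq_count (A : Set ℕ+) (N : ℕ) :
    prefixCount A N = Nat.count (fun k => Nat.succPNat k ∈ A) N := by
  rw [Nat.count_eq_card_filter_range, ← Set.ncard_coe_finset, prefixCount,
    ← Set.ncard_image_of_injective _ Nat.succPNat_injective]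
  congr 1
  ext n
  simp only [Set.mem_ofPred_eq, Finset.coe_filter, Finset.mem_range, Set.mem_image]
  constructor
  · rintro ⟨h₁, h₂⟩
    refine ⟨n.natPred, ⟨?_, by simpa using h₂⟩, by simp⟩
    have := n.natPred_add_one
    omega
  · rintro ⟨k, ⟨h₁, h₂⟩, rfl⟩
    exact ⟨by simpa using h₁, h₂⟩

open Classical in
lemma prefixCount_eq_sum (A : Set ℕ+) (N : ℕ) :
    (prefixCount A N : ℝ) =
      ∑ k ∈ Finset.Icc 1 N, ((↑) '' A : Set ℕ).indicator (1 : ℕ → ℝ) k := by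
  simp only [Set.indicator_apply, Pi.one_apply, Finset.sum_boole]
  rw [prefixCount, ← Set.ncard_image_of_injective _ PNat.coe_injective, ← Set.ncard_coe_finset]
  congr 2
  ext k
  simp only [Set.mem_image, Set.mem_ofPred_eq, Finset.coe_filter, Finset.mem_Icc]
  constructor
  · rintro ⟨n, ⟨h₁, h₂⟩, rfl⟩
    exact ⟨⟨n.pos, h₁⟩, n, h₂, rfl⟩
  · rintro ⟨⟨_, h₁⟩, n, h₂, rfl⟩
    exact ⟨n, ⟨h₁, h₂⟩, rfl⟩

lemma prefixCount_le (A : Set ℕ+) (N : ℕ) : prefixCount A N ≤ N := by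
  classical
  rw [prefixCount_eq_count]
  exact Nat.count_le _

lemma hasDensity_univ : HasDensity Set.univ 1 := by
  classical
  refine tendsto_const_nhds.congr' ?_
  filter_upwards [eventually_gt_atTop 0] with N hN
  have : (N : ℝ) ≠ 0 := by positivity
  rw [prefixCount_eq_count]
  simp [Nat.count_eq_card_filter_range, this]

/-- A set that is invariant under translation by `p` has a natural density, namely the proportion
of its elements in one period. -/
lemma exists_hasDensity_of_periodic {A : Set ℕ+} {p : ℕ+} (h : ∀ n, n + p ∈ A ↔ n ∈ A) :
    ∃ d, HasDensity A d := by
  classical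
  set q : ℕ → Prop := fun k => Nat.succPNat k ∈ A with hq
  set c : ℕ := Nat.count q p with hc
  have hper : ∀ k, q (p + k) ↔ q k := by
    intro k
    rw [hq]
    dsimp only
    rw [← h k.succPNat]
    have : (p + k : ℕ).succPNat = k.succPNat + p := by
      apply PNat.eq
      simp only [Nat.succPNat_coe, PNat.add_coe, Nat.succ_eq_add_one]
      ring
    rw [this]
  have hstep : ∀ m r : ℕ, Nat.count q (p * m + r) = m * c + Nat.count q r := by
    intro m r
    induction m with
    | zero => simp
    | succ m ih =>
      have : (p * (m + 1) + r : ℕ) = p + (p * m + r) := by ring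
      rw [this, Nat.count_add]
      simp only [hper]
      rw [ih]
      ring
  have hp : (0 : ℝ) < p := by exact_mod_cast p.pos
  refine ⟨c / p, tendsto_iff_dist_tendsto_zero.2 ?_⟩
  refine squeeze_zero' (Eventually.of_forall fun _ => dist_nonneg) ?_
    (tendsto_const_div_atTop_nhds_zero_nat (2 * p : ℝ))
  filter_upwards [eventually_gt_atTop 0] with N hN
  have hN' : (0 : ℝ) < N := by exact_mod_cast hN
  have h1 := hstep (N / p) (N % p)
  rw [Nat.div_add_mod, ← prefixCount_eq_count] at h1
  have h2 : Nat.count q (N % p) ≤ p := (Nat.count_le _).trans (Nat.mod_lt _ p.pos).le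
  have h3 : c ≤ p := Nat.count_le _
  have h4 := Nat.div_add_mod N p
  have h5 : N % p < p := Nat.mod_lt _ p.pos
  rw [Real.dist_eq, div_sub_div _ _ hN'.ne' hp.ne', abs_div, abs_of_pos (mul_pos hN' hp),
    div_le_div_iff₀ (mul_pos hN' hp) hN']
  have e1 : (prefixCount A N : ℝ) = ((N / p : ℕ) : ℝ) * c + (Nat.count q (N % p) : ℕ) := by
    exact_mod_cast h1
  have e2 : (p : ℝ) * ((N / p : ℕ) : ℝ) + ((N % p : ℕ) : ℝ) = N := by exact_mod_cast h4
  have e3 : ((Nat.count q (N % p) : ℕ) : ℝ) ≤ p := by exact_mod_cast h2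
  have e4 : (c : ℝ) ≤ p := by exact_mod_cast h3
  have e5 : ((N % p : ℕ) : ℝ) ≤ p := by exact_mod_cast h5.le
  have key : (prefixCount A N : ℝ) * p - N * c =
      (Nat.count q (N % p) : ℕ) * p - ((N % p : ℕ) : ℝ) * c := by
    rw [e1, ← e2]
    ring
  have b1 : ((Nat.count q (N % p) : ℕ) : ℝ) * p ≤ p * p := by gcongr
  have b2 : ((N % p : ℕ) : ℝ) * c ≤ p * p := by gcongr
  have b3 : |(prefixCount A N : ℝ) * p - N * c| ≤ 2 * p * p := by
    rw [key, abs_le]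
    constructor <;> nlinarith [mul_nonneg (Nat.cast_nonneg (α := ℝ) (Nat.count q (N % p))) hp.le,
      mul_nonneg (Nat.cast_nonneg (α := ℝ) (N % p)) (Nat.cast_nonneg (α := ℝ) c)]
  calc |(prefixCount A N : ℝ) * p - N * c| * N ≤ 2 * p * p * N := by gcongr
    _ = 2 * p * (N * p) := by ring

/-- A set is rational as soon as it differs from suitable periodic sets only on sets of small
upper density. -/
lemma isRationalSet_of_approx {A : Set ℕ+}
    (h : ∀ ε : ℝ, 0 < ε → ∃ (B : Set ℕ+) (p : ℕ+), (∀ n, n + p ∈ B ↔ n ∈ B) ∧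
      ∀ᶠ N : ℕ in atTop, (prefixCount {n | ¬(n ∈ A ↔ n ∈ B)} N : ℝ) / N ≤ ε) :
    IsRationalSet A := by
  classical
  intro ε hε
  obtain ⟨B, p, hp, hB⟩ := h (ε / 2) (half_pos hε)
  refine ⟨B.indicator 1, ⟨p, fun n => ?_⟩, ?_⟩
  · simp only [Set.indicator_apply, hp, Pi.one_apply]
  · have hset : {n | A.indicator (1 : ℕ+ → Fin 2) n ≠ B.indicator 1 n} =
        {n | ¬(n ∈ A ↔ n ∈ B)} := by
      ext n
      by_cases h₁ : n ∈ A <;> by_cases h₂ : n ∈ B <;> simp [h₁, h₂]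
    rw [besicovitchDist, hset]
    refine lt_of_le_of_lt (limsup_le_of_le ?_ hB) (half_lt_self hε)
    exact isCoboundedUnder_le_of_le atTop (x := 0) fun N => by positivity

/-- The factorial of `k` as a positive integer. -/
def factorialPNat (k : ℕ) : ℕ+ := Nat.toPNat k.factorial k.factorial_pos

@[simp] lemma coe_factorialPNat (k : ℕ) : (factorialPNat k : ℕ) = k.factorial := rfl

/-! ### Dirichlet series of sets and the Abelian theorem -/

/-- The Dirichlet series `∑_{n ∈ A} n⁻ˢ` of a set of positive integers, at a real argument. -/
noncomputable def dirichletSum (A : Set ℕ+) (s : ℝ) : ℝ :=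
  ∑' n : ℕ+, A.indicator (fun n : ℕ+ => ((n : ℕ) : ℝ) ^ (-s)) n

lemma indicator_rpow_nonneg (A : Set ℕ+) (s : ℝ) (n : ℕ+) :
    0 ≤ A.indicator (fun n : ℕ+ => ((n : ℕ) : ℝ) ^ (-s)) n :=
  Set.indicator_nonneg (fun _ _ => by positivity) n

lemma summable_dirichletSum (A : Set ℕ+) {s : ℝ} (hs : 1 < s) :
    Summable fun n : ℕ+ => A.indicator (fun n : ℕ+ => ((n : ℕ) : ℝ) ^ (-s)) n :=
  ((Real.summable_nat_rpow.2 (by linarith)).comp_injective PNat.coe_injective).indicator A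

/-- At a real argument, Mathlib's complex `LSeries` of the indicator function of `A` is the real
Dirichlet sum. -/
lemma LSeries_indicator_eq_dirichletSum (A : Set ℕ+) (s : ℝ) :
    LSeries (fun n => ((((↑) '' A : Set ℕ).indicator (1 : ℕ → ℝ) n : ℝ) : ℂ)) s = dirichletSum A s := by
  classical
  rw [LSeries, dirichletSum, Complex.ofReal_tsum]
  rw [← PNat.coe_injective.tsum_eq]
  · refine tsum_congr fun n => ?_
    rw [LSeries.term_of_ne_zero n.ne_zero]
    have : ((n : ℕ) ∈ (fun a : ℕ+ => (a : ℕ)) '' A) ↔ n ∈ A :=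
      PNat.coe_injective.mem_set_image
    by_cases h : n ∈ A
    · simp only [Set.indicator_of_mem h, Set.indicator_of_mem (this.2 h), Pi.one_apply,
        Complex.ofReal_one]
      rw [Complex.ofReal_cpow (by positivity), one_div, Complex.ofReal_neg, Complex.cpow_neg,
        Complex.ofReal_natCast]
    · simp only [Set.indicator_of_notMem h, Set.indicator_of_notMem (mt this.1 h),
        Complex.ofReal_zero, zero_div]
  · intro n hn
    rcases Nat.eq_zero_or_pos n with rfl | h
    · simp at hn
    · exact ⟨⟨n, h⟩, rfl⟩

lemma HasDensity.tendsto_sub_mul_dirichletSum {A : Set ℕ+} {d : ℝ} (h : HasDensity A d) :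
    Tendsto (fun s : ℝ => (s - 1) * dirichletSum A s) (𝓝[>] 1) (𝓝 d) := by
  have h₁ := LSeries_tendsto_sub_mul_nhds_one_of_tendsto_sum_div_and_nonneg
    (((↑) '' A : Set ℕ).indicator (1 : ℕ → ℝ)) (l := d)
    (by simp only [← prefixCount_eq_sum]; exact h)
    fun n => Set.indicator_nonneg (fun _ _ => zero_le_one) n
  refine Filter.tendsto_ofReal_iff.1 ?_
  refine h₁.congr' ?_
  filter_upwards [self_mem_nhdsWithin] with s hs
  rw [LSeries_indicator_eq_dirichletSum A s]
  push_cast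
  ring

lemma dirichletSum_univ_pos {s : ℝ} (hs : 1 < s) : 0 < dirichletSum Set.univ s :=
  (summable_dirichletSum Set.univ hs).tsum_pos (indicator_rpow_nonneg _ _) 1 (by simp)

/-- If `A` has a natural density, then the probability of `A` under the zeta distribution with
parameter `s` tends to it as `s` decreases to `1`. -/
lemma HasDensity.tendsto_dirichletSum_div {A : Set ℕ+} {d : ℝ} (h : HasDensity A d) :
    Tendsto (fun s : ℝ => dirichletSum A s / dirichletSum Set.univ s) (𝓝[>] 1) (𝓝 d) := by
  have := h.tendsto_sub_mul_dirichletSum.div hasDensity_univ.tendsto_sub_mul_dirichletSum one_ne_zero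
  rw [div_one] at this
  refine this.congr' ?_
  filter_upwards [self_mem_nhdsWithin] with s hs
  have hs' : s - 1 ≠ 0 := sub_ne_zero.2 (ne_of_gt hs)
  simp only [Pi.div_apply]
  exact mul_div_mul_left _ _ hs'

/-! ### Correlation inequality for the divisibility order -/

/-- The nontrivial half of the distributivity of `lcm` over `gcd`. -/
lemma PNat.gcd_lcm_dvd_lcm_gcd (a b c : ℕ+) :
    PNat.gcd (PNat.lcm a b) (PNat.lcm a c) ∣ PNat.lcm a (PNat.gcd b c) := by
  have ha := a.ne_zero
  have hb := b.ne_zero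
  have hc := c.ne_zero
  rw [PNat.dvd_iff, PNat.gcd_coe, PNat.lcm_coe, PNat.lcm_coe, PNat.lcm_coe, PNat.gcd_coe,
    ← Nat.factorization_le_iff_dvd (Nat.gcd_ne_zero_left (Nat.lcm_ne_zero ha hb))
      (Nat.lcm_ne_zero ha (Nat.gcd_ne_zero_left hb)),
    Nat.factorization_gcd (Nat.lcm_ne_zero ha hb) (Nat.lcm_ne_zero ha hc),
    Nat.factorization_lcm ha hb, Nat.factorization_lcm ha hc,
    Nat.factorization_lcm ha (Nat.gcd_ne_zero_left hb), Nat.factorization_gcd hb hc]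
  intro p
  exact le_sup_inf

/-- The positive integers, ordered by divisibility. -/
def DivisibilityOrder := ℕ+

instance : DistribLattice DivisibilityOrder where
  le := fun a b : ℕ+ => a ∣ b
  le_refl := fun a : ℕ+ => dvd_refl a
  le_trans := fun _ _ _ : ℕ+ => dvd_trans
  le_antisymm _ _ h₁ h₂ := PNat.dvd_antisymm h₁ h₂
  sup := PNat.lcm
  inf := PNat.gcd
  le_sup_left a b := PNat.dvd_lcm_left a b
  le_sup_right a b := PNat.dvd_lcm_right a b
  sup_le _ _ _ h₁ h₂ := PNat.lcm_dvd h₁ h₂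
  inf_le_left a b := PNat.gcd_dvd_left a b
  inf_le_right a b := PNat.gcd_dvd_right a b
  le_inf _ _ _ h₁ h₂ := PNat.dvd_gcd h₁ h₂
  le_sup_inf a b c := PNat.gcd_lcm_dvd_lcm_gcd a b c

open Classical in
/-- The set of divisors of `m` among the positive integers. -/
noncomputable def pnatDivisors (m : ℕ+) : Finset ℕ+ := {n ∈ Finset.Icc 1 m | n ∣ m}

lemma mem_pnatDivisors {m n : ℕ+} : n ∈ pnatDivisors m ↔ n ∣ m := by
  simp only [pnatDivisors, Finset.mem_filter, Finset.mem_Icc, one_le, true_and,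
    and_iff_right_iff_imp]
  exact PNat.le_of_dvd

/-- The correlation step: on the divisors of `m`, passing from the weights `n⁻ᵗ` to the weights
`n⁻ˢ` with `s ≤ t` multiplies by the increasing function `nᵗ⁻ˢ`, and so does not decrease the
proportion of the weight that a set closed under multiples carries. -/
lemma sum_pnatDivisors_mul_le {A : Set ℕ+} (hA : ∀ a ∈ A, ∀ b, a ∣ b → b ∈ A) {s t : ℝ}
    (hst : s ≤ t) (m : ℕ+) :
    (∑ n ∈ pnatDivisors m, A.indicator (fun n : ℕ+ => ((n : ℕ) : ℝ) ^ (-t)) n) *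
        ∑ n ∈ pnatDivisors m, ((n : ℕ) : ℝ) ^ (-s) ≤
      (∑ n ∈ pnatDivisors m, ((n : ℕ) : ℝ) ^ (-t)) *
        ∑ n ∈ pnatDivisors m, A.indicator (fun n : ℕ+ => ((n : ℕ) : ℝ) ^ (-s)) n := by
  classical
  have hmain := four_functions_theorem (α := DivisibilityOrder) (β := ℝ)
    (fun n : ℕ+ => A.indicator (fun n : ℕ+ => ((n : ℕ) : ℝ) ^ (-t)) n)
    (fun n : ℕ+ => ((n : ℕ) : ℝ) ^ (-s))
    (fun n : ℕ+ => ((n : ℕ) : ℝ) ^ (-t))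
    (fun n : ℕ+ => A.indicator (fun n : ℕ+ => ((n : ℕ) : ℝ) ^ (-s)) n)
    (indicator_rpow_nonneg A t) (fun n => by positivity) (fun n => by positivity)
    (indicator_rpow_nonneg A s) ?_ (pnatDivisors m) (pnatDivisors m)
  · refine hmain.trans ?_
    refine mul_le_mul ?_ ?_ ?_ ?_
    · refine Finset.sum_le_sum_of_subset_of_nonneg ?_ fun _ _ _ => by positivity
      intro x hx
      obtain ⟨a, ha, b, -, rfl⟩ := Finset.mem_infs.1 hx
      exact mem_pnatDivisors.2 ((PNat.gcd_dvd_left a b).trans (mem_pnatDivisors.1 ha))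
    · refine Finset.sum_le_sum_of_subset_of_nonneg ?_ fun _ _ _ => indicator_rpow_nonneg _ _ _
      intro x hx
      obtain ⟨a, ha, b, hb, rfl⟩ := Finset.mem_sups.1 hx
      exact mem_pnatDivisors.2 (PNat.lcm_dvd (mem_pnatDivisors.1 ha) (mem_pnatDivisors.1 hb))
    · exact Finset.sum_nonneg fun _ _ => indicator_rpow_nonneg _ _ _
    · exact Finset.sum_nonneg fun _ _ => by positivity
  · intro (a : ℕ+) (b : ℕ+)
    change A.indicator (fun n : ℕ+ => ((n : ℕ) : ℝ) ^ (-t)) a * ((b : ℕ) : ℝ) ^ (-s) ≤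
      ((PNat.gcd a b : ℕ+) : ℝ) ^ (-t) *
        A.indicator (fun n : ℕ+ => ((n : ℕ) : ℝ) ^ (-s)) (PNat.lcm a b)
    by_cases ha : a ∈ A
    · rw [Set.indicator_of_mem ha, Set.indicator_of_mem (hA a ha _ (PNat.dvd_lcm_left a b))]
      have hg : (0 : ℝ) < (PNat.gcd a b : ℕ+) := by exact_mod_cast (PNat.gcd a b).pos
      have hl : (0 : ℝ) < (PNat.lcm a b : ℕ+) := by exact_mod_cast (PNat.lcm a b).pos
      have ha0 : (0 : ℝ) < a := by exact_mod_cast a.pos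
      have hb0 : (0 : ℝ) < b := by exact_mod_cast b.pos
      have hga : ((PNat.gcd a b : ℕ+) : ℝ) ≤ a := by
        exact_mod_cast PNat.le_of_dvd (PNat.gcd_dvd_left a b)
      have hprod : ((PNat.gcd a b : ℕ+) : ℝ) * (PNat.lcm a b : ℕ+) = a * b := by
        exact_mod_cast PNat.gcd_mul_lcm a b
      have split : ∀ x : ℝ, 0 < x → x ^ (-t) = x ^ (-s) * x ^ (-(t - s)) := by
        intro x hx
        rw [← Real.rpow_add hx]
        ring_nf
      rw [split _ ha0, split _ hg]
      calc (a : ℝ) ^ (-s) * (a : ℝ) ^ (-(t - s)) * (b : ℝ) ^ (-s)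
          = ((a : ℝ) * b) ^ (-s) * (a : ℝ) ^ (-(t - s)) := by
            rw [Real.mul_rpow ha0.le hb0.le]
            ring
        _ ≤ ((a : ℝ) * b) ^ (-s) * ((PNat.gcd a b : ℕ+) : ℝ) ^ (-(t - s)) := by
            refine mul_le_mul_of_nonneg_left ?_ (by positivity)
            exact Real.rpow_le_rpow_of_nonpos hg hga (neg_nonpos.2 (sub_nonneg.2 hst))
        _ = _ := by
            rw [← hprod, Real.mul_rpow hg.le hl.le]
            ring
    · rw [Set.indicator_of_notMem ha, zero_mul]
      exact mul_nonneg (by positivity) (indicator_rpow_nonneg _ _ _)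

lemma tendsto_pnatDivisors_factorial :
    Tendsto (fun j : ℕ => pnatDivisors (factorialPNat j)) atTop atTop := by
  refine tendsto_atTop_finset_of_monotone (fun i j hij n hn => ?_) fun n => ⟨n, ?_⟩
  · rw [mem_pnatDivisors, PNat.dvd_iff] at *
    exact hn.trans (Nat.factorial_dvd_factorial hij)
  · rw [mem_pnatDivisors, PNat.dvd_iff]
    exact Nat.dvd_factorial n.pos le_rfl

/-- The probability of a set closed under multiples under the zeta distribution with parameter `s`
is a decreasing function of `s`. -/
lemma dirichletSum_div_antitone {A : Set ℕ+} (hA : ∀ a ∈ A, ∀ b, a ∣ b → b ∈ A) {s t : ℝ}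
    (hs : 1 < s) (hst : s ≤ t) :
    dirichletSum A t / dirichletSum Set.univ t ≤ dirichletSum A s / dirichletSum Set.univ s := by
  have ht := hs.trans_le hst
  have lim : ∀ (B : Set ℕ+) {r : ℝ}, 1 < r → Tendsto (fun j : ℕ =>
      ∑ n ∈ pnatDivisors (factorialPNat j),
        B.indicator (fun n : ℕ+ => ((n : ℕ) : ℝ) ^ (-r)) n) atTop (𝓝 (dirichletSum B r)) :=
    fun B r hr => (summable_dirichletSum B hr).hasSum.comp tendsto_pnatDivisors_factorial
  rw [div_le_div_iff₀ (dirichletSum_univ_pos ht) (dirichletSum_univ_pos hs),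
    mul_comm (dirichletSum A s)]
  refine le_of_tendsto_of_tendsto' ((lim A ht).mul (lim Set.univ hs))
    ((lim Set.univ ht).mul (lim A hs)) fun j => ?_
  simpa only [Set.indicator_univ] using sum_pnatDivisors_mul_le hA hst _

/-! ### Sets of multiples -/

/-- The multiples of those elements of `A` that do not exceed `k`. -/
def truncatedMultiples (A : Set ℕ+) (k : ℕ) : Set ℕ+ :=
  {n | ∃ a ∈ A, (a : ℕ) ≤ k ∧ a ∣ n}

lemma truncatedMultiples_periodic (A : Set ℕ+) (k : ℕ) (n : ℕ+) :
    n + factorialPNat k ∈ truncatedMultiples A k ↔ n ∈ truncatedMultiples A k := by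
  refine exists_congr fun a => and_congr_right fun _ => and_congr_right fun h => ?_
  rw [PNat.dvd_iff, PNat.dvd_iff, PNat.add_coe]
  exact (Nat.dvd_add_iff_left (Nat.dvd_factorial a.pos h)).symm

/-- A weak form of the Davenport–Erdős theorem: if a set closed under multiples has a natural
density, then its truncations approximate it in density. -/
lemma exists_truncatedMultiples_density {A : Set ℕ+} {d : ℝ}
    (hd : HasDensity A d) {ε : ℝ} (hε : 0 < ε) :
    ∃ (k : ℕ) (d' : ℝ), HasDensity (truncatedMultiples A k) d' ∧ d - ε < d' := by
  by_contra! hcon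
  have hbound : ∀ t : ℝ, 1 < t → dirichletSum A t / dirichletSum Set.univ t ≤ d - ε := by
    intro t ht
    have hk : ∀ k, dirichletSum (truncatedMultiples A k) t / dirichletSum Set.univ t ≤ d - ε := by
      intro k
      obtain ⟨d', hd'⟩ := exists_hasDensity_of_periodic (truncatedMultiples_periodic A k)
      refine le_trans ?_ (hcon k d' hd')
      refine ge_of_tendsto hd'.tendsto_dirichletSum_div ?_
      filter_upwards [Ioo_mem_nhdsGT ht] with s hs
      refine dirichletSum_div_antitone ?_ hs.1 hs.2.le
      rintro n ⟨a, ha, hak, han⟩ b hnb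
      exact ⟨a, ha, hak, han.trans hnb⟩
    have hZ := dirichletSum_univ_pos ht
    rw [div_le_iff₀ hZ]
    refine (summable_dirichletSum A ht).tsum_le_of_sum_le fun F => ?_
    -- the elements of `A` in the finite set `F` all lie in one truncation
    refine le_trans ?_ ((div_le_iff₀ hZ).1 (hk (F.sup (↑))))
    refine le_trans (Finset.sum_le_sum fun n hn => ?_)
      ((summable_dirichletSum _ ht).sum_le_tsum F fun n _ => indicator_rpow_nonneg _ _ n)
    by_cases h : n ∈ A
    · rw [Set.indicator_of_mem h, Set.indicator_of_mem]
      exact ⟨n, h, Finset.le_sup (f := fun n : ℕ+ => (n : ℕ)) hn, dvd_rfl⟩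
    · rw [Set.indicator_of_notMem h]
      exact indicator_rpow_nonneg _ _ _
  have : d ≤ d - ε := by
    refine le_of_tendsto hd.tendsto_dirichletSum_div ?_
    filter_upwards [self_mem_nhdsWithin] with t ht using hbound t ht
  linarith

/-- A set closed under multiples that has a natural density is rational, since it is approximated
from inside by its truncations, which are periodic. -/
lemma isRationalSet_of_hasDensity_of_dvd_closed {A : Set ℕ+}
    (hA : ∀ a ∈ A, ∀ b, a ∣ b → b ∈ A) {d : ℝ} (hd : HasDensity A d) : IsRationalSet A := by
  refine isRationalSet_of_approx fun ε hε => ?_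
  obtain ⟨k, d', hd', hlt⟩ := exists_truncatedMultiples_density hd hε
  refine ⟨_, _, truncatedMultiples_periodic A k, ?_⟩
  have hsub : truncatedMultiples A k ⊆ A := fun n ⟨a, ha, _, han⟩ => hA a ha n han
  have hset : {n | ¬(n ∈ A ↔ n ∈ truncatedMultiples A k)} = A \ truncatedMultiples A k := by
    ext n
    have := @hsub n
    simp only [Set.mem_ofPred_eq, Set.mem_sdiff]
    tauto
  rw [hset]
  have hlim := hd.sub hd'
  filter_upwards [hlim.eventually_lt_const (show d - d' < ε by linarith)] with N hN
  refine le_trans (le_of_eq ?_) hN.le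
  rw [← prefixCount_add_prefixCount_diff hsub N]
  push_cast
  ring

/-! ### Disjoint dilates and concentration -/

/-- `p • (A \ pℕ)` has at least `|A ∩ [1, N/p]| - N/p²` elements up to `N`. -/
lemma prefixCount_dilate_ge (A : Set ℕ+) (p : ℕ+) (N : ℕ) :
    (prefixCount A (N / p) : ℝ) - N / (p : ℝ) ^ 2 ≤
      prefixCount ((p * ·) '' {n | n ∈ A ∧ ¬ p ∣ n}) N := by
  have h₁ : prefixCount A (N / p) ≤
      prefixCount {n | n ∈ A ∧ ¬ p ∣ n} (N / p) + prefixCount {n | p ∣ n} (N / p) := by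
    refine (prefixCount_mono (fun n hn => ?_) _).trans (prefixCount_union_le _ _ _)
    by_cases h : p ∣ n
    · exact Or.inr h
    · exact Or.inl ⟨hn, h⟩
  have hdil : ∀ (B : Set ℕ+) (M : ℕ), prefixCount ((p * ·) '' B) M = prefixCount B (M / p) := by
    intro B M
    rw [prefixCount, prefixCount, ← Set.ncard_image_of_injective
      {n : ℕ+ | (n : ℕ) ≤ M / p ∧ n ∈ B} (mul_right_injective p)]
    congr 1
    ext n
    simp only [Set.mem_ofPred_eq, Set.mem_image]
    constructor
    · rintro ⟨h, m, hm, rfl⟩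
      refine ⟨m, ⟨?_, hm⟩, rfl⟩
      rwa [Nat.le_div_iff_mul_le p.pos, mul_comm, ← PNat.mul_coe]
    · rintro ⟨m, ⟨h, hm⟩, rfl⟩
      refine ⟨?_, m, hm, rfl⟩
      rwa [PNat.mul_coe, mul_comm, ← Nat.le_div_iff_mul_le p.pos]
  have h₂ : (prefixCount {n | p ∣ n} (N / p) : ℝ) ≤ N / (p : ℝ) ^ 2 := by
    have : {n | p ∣ n} = (p * ·) '' Set.univ := by
      ext n
      simp only [Set.mem_ofPred_eq, Set.image_univ, Set.mem_range, dvd_def, eq_comm]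
    rw [this, hdil]
    calc (prefixCount Set.univ (N / p / p) : ℝ) ≤ ((N / p / p : ℕ) : ℝ) := by
          exact_mod_cast prefixCount_le _ _
      _ ≤ N / (p : ℝ) ^ 2 := by
          rw [Nat.div_div_eq_div_mul, sq]
          exact_mod_cast Nat.cast_div_le (α := ℝ) (m := N) (n := p * p)
  rw [hdil]
  have : (prefixCount A (N / p) : ℝ) ≤
      prefixCount {n | n ∈ A ∧ ¬ p ∣ n} (N / p) + prefixCount {n | p ∣ n} (N / p) := by
    exact_mod_cast h₁
  linarith

/-- Pairwise disjoint sets together have at most `N` elements up to `N`. -/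
lemma sum_prefixCount_le {ι : Type*} (P : Finset ι) (A : ι → Set ℕ+)
    (hA : ∀ i ∈ P, ∀ j ∈ P, i ≠ j → Disjoint (A i) (A j)) (N : ℕ) :
    ∑ i ∈ P, prefixCount (A i) N ≤ N := by
  classical
  simp only [prefixCount_eq_count, Nat.count_eq_card_filter_range]
  rw [← Finset.card_biUnion]
  · refine (Finset.card_le_card (Finset.biUnion_subset.2 fun i _ => Finset.filter_subset _ _)).trans ?_
    simp
  · intro i hi j hj hij
    refine Finset.disjoint_left.2 fun n h₁ h₂ => ?_
    exact Set.disjoint_left.1 (hA i hi j hj hij) (Finset.mem_filter.1 h₁).2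
      (Finset.mem_filter.1 h₂).2

lemma HasDensity.tendsto_prefixCount_div_div {A : Set ℕ+} {d : ℝ} (h : HasDensity A d) (p : ℕ+) :
    Tendsto (fun N : ℕ => (prefixCount A (N / p) : ℝ) / N) atTop (𝓝 (d / p)) := by
  have h₁ : Tendsto (fun N : ℕ => N / (p : ℕ)) atTop atTop :=
    Nat.tendsto_div_const_atTop p.ne_zero
  have h₂ : Tendsto (fun N : ℕ => ((N / p : ℕ) : ℝ) / N) atTop (𝓝 (1 / p)) := by
    refine ((tendsto_nat_floor_mul_div_atTop (R := ℝ) (a := 1 / (p : ℝ)) (by positivity)).comp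
      tendsto_natCast_atTop_atTop).congr fun N => ?_
    simp only [Function.comp_apply]
    rw [one_div, inv_mul_eq_div, Nat.floor_div_eq_div]
  have h₃ := (h.comp h₁).mul h₂
  rw [mul_one_div] at h₃
  refine h₃.congr' ?_
  filter_upwards [h₁.eventually_gt_atTop 0] with N hN
  have : ((N / p : ℕ) : ℝ) ≠ 0 := by exact_mod_cast hN.ne'
  exact div_mul_div_cancel₀ this

/-- If the sets `p • (A \ pℕ)`, for `p` in a finite set `P`, are pairwise disjoint, then the density
of `A` is at most of the order of `1 / ∑ 1/p`. -/
lemma HasDensity.mul_sum_le {A : Set ℕ+} {d : ℝ} (h : HasDensity A d) (P : Finset ℕ+)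
    (hP : ∀ p ∈ P, ∀ q ∈ P, p ≠ q → ∀ m ∈ A, ∀ n ∈ A, ¬ p ∣ m → ¬ q ∣ n → p * m ≠ q * n) :
    d * ∑ p ∈ P, 1 / (p : ℝ) ≤ 1 + ∑ p ∈ P, 1 / (p : ℝ) ^ 2 := by
  have hlim : Tendsto (fun N : ℕ => ∑ p ∈ P, ((prefixCount A (N / p) : ℝ) / N - 1 / (p : ℝ) ^ 2))
      atTop (𝓝 (∑ p ∈ P, (d / p - 1 / (p : ℝ) ^ 2))) :=
    tendsto_finsetSum _ fun p _ => (h.tendsto_prefixCount_div_div p).sub_const _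
  have hle : ∑ p ∈ P, (d / p - 1 / (p : ℝ) ^ 2) ≤ 1 := by
    refine le_of_tendsto hlim ?_
    filter_upwards [eventually_gt_atTop 0] with N hN
    have hN' : (0 : ℝ) < N := by exact_mod_cast hN
    have h₁ : ∑ p ∈ P, ((prefixCount A (N / p) : ℝ) - N / (p : ℝ) ^ 2) ≤ N := by
      refine (Finset.sum_le_sum fun p _ => prefixCount_dilate_ge A p N).trans ?_
      exact_mod_cast sum_prefixCount_le P (fun p => (p * ·) '' {n | n ∈ A ∧ ¬ p ∣ n}) (by
        intro p hp q hq hpq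
        refine Set.disjoint_left.2 ?_
        rintro _ ⟨m, hm, rfl⟩ ⟨n, hn, h'⟩
        exact hP p hp q hq hpq m hm.1 n hn.1 hm.2 hn.2 h'.symm) N
    calc ∑ p ∈ P, ((prefixCount A (N / p) : ℝ) / N - 1 / (p : ℝ) ^ 2)
        = (∑ p ∈ P, ((prefixCount A (N / p) : ℝ) - N / (p : ℝ) ^ 2)) / N := by
          rw [Finset.sum_div]
          refine Finset.sum_congr rfl fun p _ => ?_
          field_simp
      _ ≤ 1 := div_le_one_of_le₀ h₁ hN'.le
  rw [Finset.sum_sub_distrib] at hle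
  rw [Finset.mul_sum]
  simp only [mul_one_div]
  linarith

lemma exists_finset_primes_sum_gt (C : ℝ) :
    ∃ P : Finset ℕ+, (∀ p ∈ P, (p : ℕ).Prime) ∧ C < ∑ p ∈ P, 1 / (p : ℝ) := by
  by_contra! hcon
  let e : ({p : ℕ | p.Prime} : Set ℕ) ↪ ℕ+ :=
    ⟨fun p => Nat.toPNat p (Nat.Prime.pos p.2), fun p q h => Subtype.ext (congrArg PNat.val h)⟩
  have hsum : Summable ((fun n : ℕ => 1 / (n : ℝ)) ∘ ((↑) : ({p : ℕ | p.Prime} : Set ℕ) → ℕ)) := by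
    refine summable_of_sum_le (c := C) (fun p => ?_) fun F => ?_
    · simp only [Function.comp_apply, Pi.zero_apply]
      positivity
    · have h := hcon (F.map e) fun p hp => by
        obtain ⟨q, -, rfl⟩ := Finset.mem_map.1 hp
        exact q.2
      rw [Finset.sum_map] at h
      exact h
  exact not_summable_one_div_on_primes (summable_subtype_iff_indicator.1 hsum)

/-! ### Multiplicative functions of the form `∑_{d ∣ n} c(d) / d` -/

/-- The functions to which the approximation argument applies: divisor sums `∑_{d ∣ n} c(d) / d`
with coefficients bounded by `1` that satisfy `h(pn) = h(p) h(n)` for primes `p ∤ n`, with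
distinct positive values at distinct primes. Both `σ(n)/n` and `φ(n)/n` are of this kind. -/
structure IsDivisorRatio (c h : ℕ → ℝ) : Prop where
  abs_coeff_le : ∀ d, |c d| ≤ 1
  eq_sum : ∀ n, n ≠ 0 → h n = ∑ d ∈ n.divisors, c d / d
  map_prime_mul : ∀ p n, p.Prime → ¬ p ∣ n → h (p * n) = h p * h n
  pos_of_prime : ∀ p, p.Prime → 0 < h p
  injOn_primes : ∀ p q, p.Prime → q.Prime → h p = h q → p = q

/-- Distinct dilation factors move a small enough neighbourhood of `t > 0` to disjoint sets. -/
lemma exists_pos_separation {ι : Type*} (P : Finset ι) (h : ι → ℝ) (hpos : ∀ i ∈ P, 0 < h i)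
    (hinj : ∀ i ∈ P, ∀ j ∈ P, h i = h j → i = j) {t : ℝ} (ht : 0 < t) :
    ∃ δ > 0, ∀ i ∈ P, ∀ j ∈ P, i ≠ j → ∀ u v : ℝ, |u - t| ≤ δ → |v - t| ≤ δ →
      h i * u ≠ h j * v := by
  have hev : ∀ᶠ δ in 𝓝[>] (0 : ℝ), ∀ i ∈ P, ∀ j ∈ P, i ≠ j →
      (h i + h j) * δ < |h i - h j| * t := by
    refine (eventually_all_finset P).2 fun i hi => (eventually_all_finset P).2 fun j hj => ?_
    by_cases hij : i = j
    · simp [hij]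
    have hlim : Tendsto (fun δ : ℝ => (h i + h j) * δ) (𝓝[>] 0) (𝓝 ((h i + h j) * 0)) :=
      (tendsto_id.const_mul _).mono_left nhdsWithin_le_nhds
    have : (h i + h j) * 0 < |h i - h j| * t := by
      rw [mul_zero]
      exact mul_pos (abs_pos.2 (sub_ne_zero.2 fun e => hij (hinj i hi j hj e))) ht
    filter_upwards [hlim.eventually_lt_const this] with δ hδ _ using hδ
  obtain ⟨δ, hδ, hδ0⟩ := (hev.and self_mem_nhdsWithin).exists
  refine ⟨δ, hδ0, fun i hi j hj hij u v hu hv heq => ?_⟩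
  have h₁ := hδ i hi j hj hij
  have h₂ : (h i - h j) * t = h j * (v - t) - h i * (u - t) := by linear_combination heq
  have h₃ : |h i - h j| * t ≤ (h i + h j) * δ := by
    nth_rewrite 1 [← abs_of_pos ht]
    rw [← abs_mul, h₂]
    refine (abs_sub _ _).trans ?_
    rw [abs_mul, abs_mul, abs_of_pos (hpos i hi), abs_of_pos (hpos j hj)]
    nlinarith [hpos i hi, hpos j hj]
  linarith

namespace IsDivisorRatio

variable {c h : ℕ → ℝ}

lemma map_gcd_prime_mul (hc : IsDivisorRatio c h) {p n M : ℕ} (hp : p.Prime) (hpM : p ∣ M)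
    (hpn : ¬ p ∣ n) : h ((p * n).gcd M) = h p * h (n.gcd M) := by
  obtain ⟨M', rfl⟩ := hpM
  rw [Nat.gcd_mul_left, Nat.Coprime.gcd_mul_left_cancel_right M'
    ((Nat.Prime.coprime_iff_not_dvd hp).2 hpn)]
  exact hc.map_prime_mul p _ hp fun hd => hpn (hd.trans (Nat.gcd_dvd_left _ _))

/-- The values `h(gcd(n, M))` do not concentrate near `t > 0`, uniformly in all `M` with enough
prime divisors. If `h(gcd(n, M))` is close to `t` and `p ∤ n`, then `h(gcd(pn, M))` is close to
`h(p) t`, so that the dilates of the concentration set by different primes are disjoint. -/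
lemma exists_concentration_bound (hc : IsDivisorRatio c h) {t : ℝ} (ht : 0 < t) {ε : ℝ}
    (hε : 0 < ε) :
    ∃ δ > 0, ∃ K₀ : ℕ, ∀ K ≥ K₀, ∀ d : ℝ,
      HasDensity {n : ℕ+ | |h ((n : ℕ).gcd K.factorial) - t| ≤ δ} d → d < ε := by
  have hsumm : Summable fun p : ℕ+ => 1 / (p : ℝ) ^ 2 :=
    (Real.summable_one_div_nat_pow.2 one_lt_two).comp_injective PNat.coe_injective
  set C : ℝ := 1 + ∑' p : ℕ+, 1 / (p : ℝ) ^ 2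
  have hC0 : 0 < C := add_pos_of_pos_of_nonneg one_pos (tsum_nonneg fun p => by positivity)
  -- `P` depends on `ε` only, and `δ` on `P`; any `K` at least as large as all of `P` then works
  obtain ⟨P, hP, hsum⟩ := exists_finset_primes_sum_gt (C / ε)
  obtain ⟨δ, hδ, hsep⟩ := exists_pos_separation P (fun p : ℕ+ => h p)
    (fun p hp => hc.pos_of_prime p (hP p hp))
    (fun p hp q hq e => PNat.eq (hc.injOn_primes p q (hP p hp) (hP q hq) e)) ht
  refine ⟨δ, hδ, P.sup (↑), fun K hK d hd => ?_⟩
  have hdvd : ∀ p ∈ P, (p : ℕ) ∣ K.factorial := fun p hp =>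
    Nat.dvd_factorial p.pos ((Finset.le_sup (f := fun p : ℕ+ => (p : ℕ)) hp).trans hK)
  have hle := hd.mul_sum_le P (by
    intro p hp q hq hpq m hm n hn hpm hqn heq
    refine hsep p hp q hq hpq _ _ hm hn ?_
    rw [PNat.dvd_iff] at hpm hqn
    rw [← hc.map_gcd_prime_mul (hP p hp) (hdvd p hp) hpm,
      ← hc.map_gcd_prime_mul (hP q hq) (hdvd q hq) hqn, ← PNat.mul_coe, ← PNat.mul_coe, heq])
  have hle' : d * ∑ p ∈ P, 1 / (p : ℝ) ≤ C :=
    hle.trans (add_le_add_right (hsumm.sum_le_tsum P fun p _ => by positivity) 1)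
  by_contra! hcon
  have : C < ε * ∑ p ∈ P, 1 / (p : ℝ) := by rwa [div_lt_iff₀' hε] at hsum
  have : ε * ∑ p ∈ P, 1 / (p : ℝ) ≤ d * ∑ p ∈ P, 1 / (p : ℝ) :=
    mul_le_mul_of_nonneg_right hcon (Finset.sum_nonneg fun p _ => by positivity)
  linarith

/-- The divisors of `n` up to `K` all divide `gcd(n, K!)`, so that only larger ones contribute. -/
lemma abs_sub_map_gcd_factorial_le (hc : IsDivisorRatio c h) (K : ℕ) {n : ℕ} (hn : n ≠ 0) :
    |h n - h (n.gcd K.factorial)| ≤ ∑ d ∈ n.divisors with K < d, 1 / (d : ℝ) := by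
  have hg : n.gcd K.factorial ≠ 0 := Nat.gcd_ne_zero_left hn
  have hdiv : (n.gcd K.factorial).divisors = {d ∈ n.divisors | d ∣ K.factorial} := by
    ext d
    simp only [Nat.mem_divisors, Finset.mem_filter, Nat.dvd_gcd_iff]
    tauto
  rw [hc.eq_sum n hn, hc.eq_sum _ hg, hdiv,
    ← Finset.sum_filter_add_sum_filter_not n.divisors (· ∣ K.factorial), add_sub_cancel_left]
  refine (Finset.abs_sum_le_sum_abs _ _).trans ?_
  refine (Finset.sum_le_sum fun d _ => ?_).trans
    (Finset.sum_le_sum_of_subset_of_nonneg ?_ fun _ _ _ => by positivity)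
  · rw [abs_div, Nat.abs_cast]
    exact div_le_div_of_nonneg_right (hc.abs_coeff_le d) (Nat.cast_nonneg d)
  · intro d hd
    rw [Finset.mem_filter] at hd ⊢
    refine ⟨hd.1, not_le.1 fun hdK => hd.2 (Nat.dvd_factorial ?_ hdK)⟩
    exact Nat.pos_of_mem_divisors hd.1

end IsDivisorRatio

/-- The divisors exceeding `K` contribute at most `1 / K` to the mean value of `∑_{d ∣ n} 1/d`. -/
lemma sum_sum_divisors_gt_le {K : ℕ} (hK : K ≠ 0) (N : ℕ) :
    ∑ n ∈ Finset.Icc 1 N, ∑ d ∈ n.divisors with K < d, 1 / (d : ℝ) ≤ N / K := by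
  have hswap : ∑ n ∈ Finset.Icc 1 N, ∑ d ∈ n.divisors with K < d, 1 / (d : ℝ) =
      ∑ d ∈ Finset.Ioc K N, ∑ n ∈ Finset.Ioc 0 N with d ∣ n, 1 / (d : ℝ) := by
    refine Finset.sum_comm' fun n d => ?_
    simp only [Finset.mem_Icc, Finset.mem_Ioc, Finset.mem_filter, Nat.mem_divisors]
    constructor
    · rintro ⟨⟨h₁, h₂⟩, ⟨h₃, _⟩, h₄⟩
      exact ⟨⟨⟨h₁, h₂⟩, h₃⟩, h₄, (Nat.le_of_dvd h₁ h₃).trans h₂⟩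
    · rintro ⟨⟨⟨h₁, h₂⟩, h₃⟩, h₄, _⟩
      exact ⟨⟨h₁, h₂⟩, ⟨h₃, by omega⟩, h₄⟩
  rw [hswap]
  calc ∑ d ∈ Finset.Ioc K N, ∑ n ∈ Finset.Ioc 0 N with d ∣ n, 1 / (d : ℝ)
      ≤ ∑ d ∈ Finset.Ioc K N, N * ((d : ℝ) ^ 2)⁻¹ := by
        refine Finset.sum_le_sum fun d hd => ?_
        rw [Finset.sum_const, Nat.Ioc_filter_dvd_card_eq_div, nsmul_eq_mul]
        calc ((N / d : ℕ) : ℝ) * (1 / d) ≤ (N / d : ℝ) * (1 / d) := by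
              gcongr
              exact Nat.cast_div_le
          _ = N * ((d : ℝ) ^ 2)⁻¹ := by ring
    _ = N * ∑ d ∈ Finset.Ioc K N, ((d : ℝ) ^ 2)⁻¹ := by rw [Finset.mul_sum]
    _ ≤ N * (1 / K) := by
        refine mul_le_mul_of_nonneg_left ?_ (Nat.cast_nonneg N)
        rcases le_total K N with h | h
        · refine (sum_Ioc_inv_sq_le_sub hK h).trans ?_
          rw [one_div]
          exact sub_le_self _ (by positivity)
        · rw [Finset.Ioc_eq_empty (not_lt.2 h)]
          simp
    _ = N / K := mul_one_div _ _

namespace IsDivisorRatio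

variable {c h : ℕ → ℝ}

/-- The integers at which truncating the divisor sum changes it by more than `δ` are rare, by
Markov's inequality. -/
lemma prefixCount_abs_sub_gt_le (hc : IsDivisorRatio c h) {K : ℕ} (hK : K ≠ 0) {δ : ℝ}
    (hδ : 0 < δ) (N : ℕ) :
    (prefixCount {n : ℕ+ | δ < |h n - h ((n : ℕ).gcd K.factorial)|} N : ℝ) ≤ N / (K * δ) := by
  have hsum : δ * (prefixCount {n : ℕ+ | δ < |h n - h ((n : ℕ).gcd K.factorial)|} N : ℝ) ≤
      N / K := by
    refine le_trans ?_ (sum_sum_divisors_gt_le hK N)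
    rw [prefixCount_eq_sum, Finset.mul_sum]
    refine Finset.sum_le_sum fun n hn => ?_
    have hn0 : n ≠ 0 := (Nat.pos_of_ne_zero (by simp at hn; omega)).ne'
    refine le_trans ?_ (hc.abs_sub_map_gcd_factorial_le K hn0)
    by_cases hmem : n ∈ ((↑) '' {n : ℕ+ | δ < |h n - h ((n : ℕ).gcd K.factorial)|} : Set ℕ)
    · rw [Set.indicator_of_mem hmem, Pi.one_apply, mul_one]
      obtain ⟨m, hm, rfl⟩ := hmem
      exact hm.le
    · rw [Set.indicator_of_notMem hmem, mul_zero]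
      exact abs_nonneg _
  have hK' : (0 : ℝ) < K := by positivity
  rw [le_div_iff₀ (by positivity)]
  rw [le_div_iff₀ hK'] at hsum
  linarith

/-- A level set of `h` at a positive threshold `t` is rational: it is approximated by the
corresponding level sets of the periodic functions `h(gcd(n, K!))`. The hypothesis `hI` says that
`I` is insensitive to perturbations that cannot cross `t`, as is the case for both half-lines with
endpoint `t`. -/
lemma isRationalSet_preimage (hc : IsDivisorRatio c h) {t : ℝ} (ht : 0 < t) {I : Set ℝ}
    (hI : ∀ u v δ : ℝ, |u - v| ≤ δ → δ < |v - t| → (u ∈ I ↔ v ∈ I)) :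
    IsRationalSet {n : ℕ+ | h n ∈ I} := by
  refine isRationalSet_of_approx fun ε hε => ?_
  obtain ⟨δ, hδ, K₀, hconc⟩ := hc.exists_concentration_bound ht (half_pos hε)
  -- this choice makes the tail bound `1 / (K δ)` at most `ε / 2`
  obtain ⟨K₁, hK₁⟩ := exists_nat_gt (2 / (ε * δ))
  set K := max K₀ (max K₁ 1)
  have hK : K ≠ 0 := by omega
  have hper : ∀ n : ℕ+, ((n + factorialPNat K : ℕ+) : ℕ).gcd K.factorial =
      (n : ℕ).gcd K.factorial := by
    intro n
    rw [PNat.add_coe, coe_factorialPNat, Nat.gcd_add_self_left]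
  refine ⟨{n | h ((n : ℕ).gcd K.factorial) ∈ I}, factorialPNat K, fun n => ?_, ?_⟩
  · simp only [Set.mem_ofPred_eq, hper]
  obtain ⟨d, hd⟩ := exists_hasDensity_of_periodic
    (A := {n : ℕ+ | |h ((n : ℕ).gcd K.factorial) - t| ≤ δ}) (p := factorialPNat K)
    fun n => by simp only [Set.mem_ofPred_eq, hper]
  have hdε := hconc K (le_max_left _ _) d hd
  have hsub : {n : ℕ+ | ¬(n ∈ {n : ℕ+ | h n ∈ I} ↔
      n ∈ {n : ℕ+ | h ((n : ℕ).gcd K.factorial) ∈ I})} ⊆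
      {n : ℕ+ | |h ((n : ℕ).gcd K.factorial) - t| ≤ δ} ∪
        {n : ℕ+ | δ < |h n - h ((n : ℕ).gcd K.factorial)|} := by
    intro n hn
    by_contra hcon
    rw [Set.mem_union, not_or] at hcon
    exact hn (hI _ _ δ (not_lt.1 hcon.2) (not_le.1 hcon.1))
  filter_upwards [hd.eventually_lt_const hdε, eventually_gt_atTop 0] with N hN hN0
  have hN' : (0 : ℝ) < N := by exact_mod_cast hN0
  have hcount := (prefixCount_mono hsub N).trans (prefixCount_union_le _ _ N)
  have hcount' := (Nat.cast_le (α := ℝ)).2 hcount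
  have htail := hc.prefixCount_abs_sub_gt_le hK hδ N
  have hKbig : 1 / (K * δ) ≤ ε / 2 := by
    have : (K₁ : ℝ) ≤ K := by exact_mod_cast (le_max_left _ _).trans (le_max_right _ _)
    have h₁ := (div_lt_iff₀ (by positivity)).1 (hK₁.trans_le this)
    rw [div_le_div_iff₀ (by positivity) two_pos]
    linarith
  push_cast at hcount'
  rw [div_lt_iff₀ hN'] at hN
  rw [div_le_iff₀ hN']
  have : (N : ℝ) / (K * δ) ≤ ε / 2 * N := by
    rw [div_eq_mul_one_div, mul_comm]
    exact mul_le_mul_of_nonneg_right hKbig hN'.le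
  refine hcount'.trans ?_
  linarith

lemma isRationalSet_lt (hc : IsDivisorRatio c h) {t : ℝ} (ht : 0 < t) :
    IsRationalSet {n : ℕ+ | h n < t} := by
  refine hc.isRationalSet_preimage ht (I := Set.Iio t) fun u v δ h₁ h₂ => ?_
  rw [abs_le] at h₁
  rw [lt_abs] at h₂
  simp only [Set.mem_Iio]
  constructor <;> intro <;> rcases h₂ with h₂ | h₂ <;> linarith

lemma isRationalSet_gt (hc : IsDivisorRatio c h) {t : ℝ} (ht : 0 < t) :
    IsRationalSet {n : ℕ+ | t < h n} := by
  refine hc.isRationalSet_preimage ht (I := Set.Ioi t) fun u v δ h₁ h₂ => ?_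
  rw [abs_le] at h₁
  rw [lt_abs] at h₂
  simp only [Set.mem_Ioi]
  constructor <;> intro <;> rcases h₂ with h₂ | h₂ <;> linarith

end IsDivisorRatio

/-! ### The functions `σ(n)/n` and `φ(n)/n` -/

lemma isDivisorRatio_sigma :
    IsDivisorRatio (fun _ => 1) fun n => (ArithmeticFunction.sigma 1 n : ℝ) / n where
  abs_coeff_le d := by simp
  eq_sum n hn := by
    rw [ArithmeticFunction.sigma_eq_sum_div, Nat.cast_sum, Finset.sum_div]
    refine Finset.sum_congr rfl fun d hd => ?_
    have hd0 : (d : ℝ) ≠ 0 := by exact_mod_cast (Nat.pos_of_mem_divisors hd).ne'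
    have hn0 : (n : ℝ) ≠ 0 := by exact_mod_cast hn
    rw [pow_one, Nat.cast_div (Nat.dvd_of_mem_divisors hd) hd0]
    field_simp
  map_prime_mul p n hp hpn := by
    rw [ArithmeticFunction.isMultiplicative_sigma.map_mul_of_coprime
      ((Nat.Prime.coprime_iff_not_dvd hp).2 hpn)]
    push_cast
    rw [mul_div_mul_comm]
  pos_of_prime p hp := by
    have := hp.pos
    rw [ArithmeticFunction.sigma_one_apply, hp.sum_divisors]
    positivity
  injOn_primes p q hp hq hpq := by
    have hp0 : (p : ℝ) ≠ 0 := by exact_mod_cast hp.ne_zero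
    have hq0 : (q : ℝ) ≠ 0 := by exact_mod_cast hq.ne_zero
    rw [ArithmeticFunction.sigma_one_apply, ArithmeticFunction.sigma_one_apply, hp.sum_divisors,
      hq.sum_divisors, div_eq_div_iff hp0 hq0] at hpq
    push_cast at hpq
    exact_mod_cast (show (p : ℝ) = q by linarith)

lemma isDivisorRatio_totient :
    IsDivisorRatio (fun d => (ArithmeticFunction.moebius d : ℝ)) fun n => (n.totient : ℝ) / n where
  abs_coeff_le d := by
    exact_mod_cast ArithmeticFunction.abs_moebius_le_one
  eq_sum n hn := by
    have hn0 : (n : ℝ) ≠ 0 := by exact_mod_cast hn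
    have hinv := (ArithmeticFunction.sum_eq_iff_sum_mul_moebius_eq (R := ℝ)
      (f := fun n => (n.totient : ℝ)) (g := fun n => (n : ℝ))).1
      (fun m _ => by exact_mod_cast Nat.sum_totient m) n (Nat.pos_of_ne_zero hn)
    rw [← hinv, Nat.sum_divisorsAntidiagonal
      (f := fun a b => ((ArithmeticFunction.moebius a : ℤ) : ℝ) * (b : ℝ)), Finset.sum_div]
    refine Finset.sum_congr rfl fun d hd => ?_
    have hd0 : (d : ℝ) ≠ 0 := by exact_mod_cast (Nat.pos_of_mem_divisors hd).ne'
    rw [Nat.cast_div (Nat.dvd_of_mem_divisors hd) hd0]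
    field_simp
  map_prime_mul p n hp hpn := by
    rw [Nat.totient_mul ((Nat.Prime.coprime_iff_not_dvd hp).2 hpn)]
    push_cast
    rw [mul_div_mul_comm]
  pos_of_prime p hp := by
    have h₁ := hp.pos
    have h₂ := Nat.totient_pos.2 h₁
    positivity
  injOn_primes p q hp hq hpq := by
    have hp0 : (p : ℝ) ≠ 0 := by exact_mod_cast hp.ne_zero
    have hq0 : (q : ℝ) ≠ 0 := by exact_mod_cast hq.ne_zero
    rw [Nat.totient_prime hp, Nat.totient_prime hq, div_eq_div_iff hp0 hq0,
      Nat.cast_sub hp.one_le, Nat.cast_sub hq.one_le] at hpq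
    push_cast at hpq
    exact_mod_cast (show (p : ℝ) = q by linarith)

theorem mainTheorem12 :
    (∀ A : Set ℕ+, A ⊆ {1}ᶜ →
      (∃ d : ℝ, HasDensity A d) →
      (∀ n : ℕ+, (fun a : ℕ+ => n * a) '' A ⊆ A) →
      IsRationalSet A) ∧
    IsRationalSet abundantNumbers ∧
    IsRationalSet deficientNumbers ∧
    (∀ x ∈ Set.Icc (0 : ℝ) 1, IsRationalSet (totientRatioSet x)) := by
  refine ⟨fun A _ ⟨d, hd⟩ hA => ?_, ?_, ?_, fun x hx => ?_⟩
  · refine isRationalSet_of_hasDensity_of_dvd_closed ?_ hd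
    rintro a ha _ ⟨k, rfl⟩
    exact hA k ⟨a, ha, mul_comm _ _⟩
  · convert isDivisorRatio_sigma.isRationalSet_gt two_pos using 1
    ext n
    have hn : (0 : ℝ) < (n : ℕ) := by exact_mod_cast n.pos
    simp only [abundantNumbers, Set.mem_ofPred_eq, lt_div_iff₀ hn]
    exact_mod_cast Iff.rfl
  · convert isDivisorRatio_sigma.isRationalSet_lt two_pos using 1
    ext n
    have hn : (0 : ℝ) < (n : ℕ) := by exact_mod_cast n.pos
    simp only [deficientNumbers, Set.mem_ofPred_eq, div_lt_iff₀ hn]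
    exact_mod_cast Iff.rfl
  · rcases hx.1.eq_or_lt with rfl | hx0
    · -- the set is empty for `x = 0`
      have hempty : totientRatioSet 0 = ∅ := by
        ext n
        simp only [totientRatioSet, Set.mem_ofPred_eq, Set.mem_empty_iff_false, iff_false, not_lt]
        positivity
      rw [hempty]
      refine isRationalSet_of_approx fun ε hε => ⟨∅, 1, fun n => by simp, ?_⟩
      exact Eventually.of_forall fun N => by simpa [prefixCount] using hε.le
    · exact isDivisorRatio_totient.isRationalSet_lt hx0
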